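/- Let $D,d\ge 0$ and $N\ge 1$ be integers, let $\mathfrak F:\mathbb R^D\times\mathbb R^d\to\mathbb R$ be a smooth ($C^\infty$) network function, and let $(y_i,z_i)\in\mathbb R^d\times\mathbb R$, $i\in[N]=\{1,\dots,N\}$, be training data. Let $\ell:\mathbb R\times\mathbb R\to[0,\infty)$ be a loss function that is $C^2$ in its first argument, with $\ell(\bar z,z)=0$ if and only if $\bar z=z$, and with $\partial_1\ell(z,z)=0$ and $\partial_1^2\ell(z,z)=1$ for all $z$. Put $$\mathcal L_i(x)=\ell(\mathfrak F(x,y_i),z_i),\qquad \mathcal L(x)=\frac1N\sum_{i=1}^N\mathcal L_i(x),\qquad \mathcal M=\{x\in\mathbb R^D:\mathcal L(x)=0\},$$ and, for a fixed learning rate $\eta>0$, $\mathcal G_\eta(x)=x-\eta\nabla\mathcal L(x)$ and $\mathcal G_{\eta,i}(x)=x-\eta\nabla\mathcal L_i(x)$. Assume: 1. for every $x\in\mathcal M$ the gradients $\nabla_x\mathfrak F(x,y_1),\dots,\nabla_x\mathfrak F(x,y_N)$ are linearly independent (so $\mathcal M$ is an embedded submanifold of $\mathbb R^D$); 2. the initial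 distribution $\nu$, a Borel probability measure on $\mathbb R^D$, is equivalent to Lebesgue measure, i.e. $\nu(B)=0\Leftrightarrow \operatorname{Leb}(B)=0$ for all Borel sets $B$; 3. the maps $\mathcal G_\eta,\mathcal G_{\eta,1},\dots,\mathcal G_{\eta,N}$ are non-singular, i.e. the preimage of every Lebesgue-null set is Lebesgue-null. Let $X_0$ be a random variable with law $\nu$ on a probability space with probability measure $\mathbb P$, let $X_{n+1}=\mathcal G_\eta(X_n)$ be the gradient descent sequence started in $X_0$, and let the $\mathcal M\cup\{\emptyset\}$-valued random variable $X_{\lim}^{\mathrm{GD}}$ be $\lim_n X_n$ if $(X_n)$ converges to a point of $\mathcal M$, and $\emptyset$ otherwise. Its support is $$\operatorname{supp}(X_{\lim}^{\mathrm{GD}})=\{x\in\mathcal M:\ \mathbb P(X_{\lim}^{\mathrm{GD}}\in U)>0\text{ for every relatively open } U\subseteq\mathcal M\text{ with }x\in U\}.$$ For $x\in\mathcal M$ let $\mathcal N(x)=\operatorname{span}\{\nabla_x\mathfrak F(x,y_i):i\in[N]\}$ and $$\mu(x)=\lim_{n\to\infty}\frac1n\log\big\|\mathcal G_\eta'(x)^n|_{\mathcal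 N(x)}\big\|\in[-\infty,\infty),\qquad \log 0=-\infty,$$ where $\|\cdot\|$ is the operator norm for the Euclidean norm. Then for every $x^*\in\mathcal M$ the limit defining $\mu(x^*)$ exists and $\mu(x^*)=\log\big\|(\mathbb 1-\eta\operatorname{Hess}\mathcal L(x^*))|_{\mathcal N(x^*)}\big\|$, and: (i) if $\mu(x^*)<0$, then $x^*\in\operatorname{supp}(X_{\lim}^{\mathrm{GD}})$; (ii) if $\mu(x^*)>0$, then $x^*\notin\operatorname{supp}(X_{\lim}^{\mathrm{GD}})$. -/

import Mathlib

open Filter Topology MeasureTheory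
open scoped ContDiff

noncomputable section

/-- The data of a scalar regression problem with `D` parameters, inputs in `ℝ^d` and `N` training
examples: a network function `F x y`, a loss function `ℓ`, and the data pairs `(y i, z i)`. -/
structure RegressionProblem (D d N : ℕ) where
  F : EuclideanSpace ℝ (Fin D) → EuclideanSpace ℝ (Fin d) → ℝ
  ℓ : ℝ → ℝ → ℝ
  y : Fin N → EuclideanSpace ℝ (Fin d)
  z : Fin N → ℝ

/-- The requirements on a loss function `ℓ (zbar, z)`: it is nonnegative, it vanishes exactly on the
diagonal, and it is `C²` in its first argument, with first derivative `0` and second derivative `1`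
on the diagonal. -/
structure IsLossFunction (ℓ : ℝ → ℝ → ℝ) : Prop where
  contDiff : ∀ z, ContDiff ℝ 2 (fun a => ℓ a z)
  nonneg : ∀ a z, 0 ≤ ℓ a z
  eq_zero_iff : ∀ a z, ℓ a z = 0 ↔ a = z
  deriv_diag : ∀ z, deriv (fun a => ℓ a z) z = 0
  deriv_two_diag : ∀ z, iteratedDeriv 2 (fun a => ℓ a z) z = 1

/-- A self-map of `ℝ^D` is non-singular if preimages of Lebesgue-null sets are Lebesgue-null. -/
def NonSingular {D : ℕ} (f : EuclideanSpace ℝ (Fin D) → EuclideanSpace ℝ (Fin D)) : Prop :=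
  ∀ A : Set (EuclideanSpace ℝ (Fin D)), volume A = 0 → volume (f ⁻¹' A) = 0

/-- The support of a random variable `X` with values in `S ∪ {∅}` (modelled as `Option S`): the
points of `S` all of whose open neighbourhoods in `S` are hit with positive probability. -/
def randomSupport {Ω S : Type*} [MeasurableSpace Ω] [TopologicalSpace S] (P : Measure Ω)
    (X : Ω → Option S) : Set S :=
  {x | ∀ U : Set S, IsOpen U → x ∈ U → 0 < P {o | ∃ u ∈ U, X o = some u}}

namespace RegressionProblem

variable {D d N : ℕ} (R : RegressionProblem D d N)

/-- The individual loss `L_i(x) = ℓ(F(x, y_i), z_i)`. -/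
def indivLoss (i : Fin N) (x : EuclideanSpace ℝ (Fin D)) : ℝ :=
  R.ℓ (R.F x (R.y i)) (R.z i)

/-- The empirical loss `L(x) = (1/N) ∑ i, L_i(x)`. -/
def empLoss (x : EuclideanSpace ℝ (Fin D)) : ℝ :=
  (1 / (N : ℝ)) * ∑ i : Fin N, R.indivLoss i x

/-- The set `M` of interpolation solutions. -/
def interpSet : Set (EuclideanSpace ℝ (Fin D)) :=
  {x | R.empLoss x = 0}

/-- The gradient `∇_x F(x, y_i)` of the network function in the parameters. -/
def netGrad (i : Fin N) (x : EuclideanSpace ℝ (Fin D)) : EuclideanSpace ℝ (Fin D) :=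
  gradient (fun x' => R.F x' (R.y i)) x

/-- The normal space `span {∇_x F(x, y_i)}`. -/
def normalSpace (x : EuclideanSpace ℝ (Fin D)) : Submodule ℝ (EuclideanSpace ℝ (Fin D)) :=
  Submodule.span ℝ (Set.range fun i => R.netGrad i x)

/-- The gradient descent map `G_η(x) = x - η ∇L(x)`. -/
def gdMap (η : ℝ) (x : EuclideanSpace ℝ (Fin D)) : EuclideanSpace ℝ (Fin D) :=
  x - η • gradient R.empLoss x

/-- The stochastic gradient descent maps `G_{η,i}(x) = x - η ∇L_i(x)`. -/
def sgdMap (η : ℝ) (i : Fin N) (x : EuclideanSpace ℝ (Fin D)) : EuclideanSpace ℝ (Fin D) :=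
  x - η • gradient (R.indivLoss i) x

/-- The Hessian of the empirical loss, as a linear operator on `ℝ^D`. -/
def hess (x : EuclideanSpace ℝ (Fin D)) :
    EuclideanSpace ℝ (Fin D) →L[ℝ] EuclideanSpace ℝ (Fin D) :=
  fderiv ℝ (gradient R.empLoss) x

/-- The sequence `n ↦ (1/n) log ‖G_η'(x)^n restricted to the normal space at x‖`, with values in
the extended reals, so that `log 0 = -∞`. -/
def muSeq (η : ℝ) (x : EuclideanSpace ℝ (Fin D)) (n : ℕ) : EReal :=
  (((n : ℝ)⁻¹ : ℝ) : EReal) *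
    ENNReal.log ‖((fderiv ℝ (R.gdMap η) x) ^ n).comp (R.normalSpace x).subtypeL‖ₑ

/-- The exponent `μ(x) = lim_n (1/n) log ‖G_η'(x)^n restricted to the normal space at x‖`. -/
def mu (η : ℝ) (x : EuclideanSpace ℝ (Fin D)) : EReal :=
  limsup (R.muSeq η x) atTop

/-- The gradient descent sequence `X_{n+1} = G_η(X_n)` started in `x₀`. -/
def gdSeq (η : ℝ) (x₀ : EuclideanSpace ℝ (Fin D)) (n : ℕ) : EuclideanSpace ℝ (Fin D) :=
  (R.gdMap η)^[n] x₀

open Classical in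
/-- The limit of gradient descent started in `x₀`, if it converges to a point of `M`, and
`∅` (that is, `none`) otherwise. -/
def gdLim (η : ℝ) (x₀ : EuclideanSpace ℝ (Fin D)) : Option R.interpSet :=
  if h : ∃ x : R.interpSet, Tendsto (R.gdSeq η x₀) atTop (𝓝 (x : EuclideanSpace ℝ (Fin D)))
  then some h.choose else none

end RegressionProblem

end

/-! At an interpolation solution p the residuals vanish, so `Hess L` reduces to the Gram operator of
the gradients divided by N. Hence A = 1 - η `Hess L` is symmetric and preserves the normal space.
The norm of A^n there is the n-th power of a = ‖A|N‖, which gives μ = log a, and its sign decides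
whether a < 1 or a > 1.

Stable case: the combined residual Ψ vanishes exactly on M and takes values in the normal space, and
Ψ(Gx) = AΨ(x) + o(Ψ(x)). Because the error is relative to Ψ and not to x - p, Ψ contracts on a full
neighbourhood although the fixed points are not isolated. Steps are O(Ψ), so orbits are Cauchy and
end in M near p (`eventually_tendsto_iterate`).

Unstable case: A has an eigenvalue of modulus > 1. Two orbits whose initial difference lies along
its eigenvector separate exponentially while both stay near p. The closed set of points with orbits
confined to a small ball thus meets each line in that direction at most once and is null
(`measure_forall_iterate_mem_closedBall_eq_zero`). Non-singularity pulls this back through all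
iterates, covering every orbit with limit in the open ball. -/

/-! ### Powers of symmetric operators -/

section OperatorPowers

variable {E : Type*} [NormedAddCommGroup E] [InnerProductSpace ℝ E]

/-- For a symmetric operator, `n ↦ ‖A ^ n v‖` is log-convex. -/
theorem norm_apply_pow_succ_sq_le (A : E →L[ℝ] E) (hA : ∀ v w, inner ℝ (A v) w = inner ℝ v (A w))
    (v : E) (n : ℕ) :
    ‖(A ^ (n + 1)) v‖ ^ 2 ≤ ‖(A ^ (n + 2)) v‖ * ‖(A ^ n) v‖ := by
  have h1 : (A ^ (n + 1)) v = A ((A ^ n) v) := by rw [pow_succ']; rfl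
  have h2 : (A ^ (n + 2)) v = A ((A ^ (n + 1)) v) := by rw [pow_succ' A (n + 1)]; rfl
  calc ‖(A ^ (n + 1)) v‖ ^ 2 = inner ℝ ((A ^ (n + 1)) v) ((A ^ (n + 1)) v) :=
        (real_inner_self_eq_norm_sq _).symm
    _ = inner ℝ ((A ^ (n + 2)) v) ((A ^ n) v) := by
        rw [h2, hA, ← h1]
    _ ≤ _ := real_inner_le_norm _ _

/-- By log-convexity the ratios ‖A^(n+1) v‖ / ‖A^n v‖ do not decrease; the first is compared with
the n-th, cross-multiplied so that zero denominators are harmless. -/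
theorem norm_mul_norm_apply_pow_le (A : E →L[ℝ] E)
    (hA : ∀ v w, inner ℝ (A v) w = inner ℝ v (A w)) (v : E) (n : ℕ) :
    ‖A v‖ * ‖(A ^ n) v‖ ≤ ‖(A ^ (n + 1)) v‖ * ‖v‖ := by
  induction n with
  | zero => simp
  | succ n ih =>
    have h := norm_apply_pow_succ_sq_le A hA v n
    rcases (norm_nonneg ((A ^ n) v)).eq_or_lt with h0 | h0
    · rw [← h0, mul_zero] at h
      have : ‖(A ^ (n + 1)) v‖ = 0 := by nlinarith [norm_nonneg ((A ^ (n + 1)) v)]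
      rw [this, mul_zero]; positivity
    · refine le_of_mul_le_mul_right ?_ h0
      calc ‖A v‖ * ‖(A ^ (n + 1)) v‖ * ‖(A ^ n) v‖
          = (‖A v‖ * ‖(A ^ n) v‖) * ‖(A ^ (n + 1)) v‖ := by ring
        _ ≤ (‖(A ^ (n + 1)) v‖ * ‖v‖) * ‖(A ^ (n + 1)) v‖ := by gcongr
        _ = ‖(A ^ (n + 1)) v‖ ^ 2 * ‖v‖ := by ring
        _ ≤ (‖(A ^ (n + 2)) v‖ * ‖(A ^ n) v‖) * ‖v‖ := by gcongr
        _ = _ := by ring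

/-- The product of the ratio bounds. It yields the lower bound on norms of powers, which
submultiplicativity cannot give. -/
theorem norm_apply_pow_le (A : E →L[ℝ] E)
    (hA : ∀ v w, inner ℝ (A v) w = inner ℝ v (A w)) (v : E) (n : ℕ) :
    ‖A v‖ ^ (n + 1) ≤ ‖(A ^ (n + 1)) v‖ * ‖v‖ ^ n := by
  induction n with
  | zero => simp
  | succ n ih =>
    calc ‖A v‖ ^ (n + 1 + 1) = ‖A v‖ * ‖A v‖ ^ (n + 1) := pow_succ' _ _
      _ ≤ ‖A v‖ * (‖(A ^ (n + 1)) v‖ * ‖v‖ ^ n) := by gcongr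
      _ = (‖A v‖ * ‖(A ^ (n + 1)) v‖) * ‖v‖ ^ n := by ring
      _ ≤ (‖(A ^ (n + 1 + 1)) v‖ * ‖v‖) * ‖v‖ ^ n := by
        exact mul_le_mul_of_nonneg_right (norm_mul_norm_apply_pow_le A hA v (n + 1))
          (by positivity)
      _ = _ := by ring

/-- The norm of a power of a symmetric operator on an invariant subspace. -/
theorem norm_pow_comp_subtypeL (A : E →L[ℝ] E)
    (hA : ∀ v w, inner ℝ (A v) w = inner ℝ v (A w)) (V : Submodule ℝ E) (hV : ∀ v ∈ V, A v ∈ V)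
    (n : ℕ) :
    ‖(A ^ (n + 1)).comp V.subtypeL‖ = ‖A.comp V.subtypeL‖ ^ (n + 1) := by
  have key : ∀ v ∈ V, ‖A v‖ ≤ ‖A.comp V.subtypeL‖ * ‖v‖ := fun v hv =>
    (A.comp V.subtypeL).le_opNorm ⟨v, hv⟩
  apply le_antisymm
  · refine ContinuousLinearMap.opNorm_le_bound _ (by positivity) fun v => ?_
    have : ∀ m : ℕ, (A ^ m) (v : E) ∈ V ∧
        ‖(A ^ m) (v : E)‖ ≤ ‖A.comp V.subtypeL‖ ^ m * ‖(v : E)‖ := by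
      intro m
      induction m with
      | zero => simp
      | succ m ih =>
        have h1 : (A ^ (m + 1)) (v : E) = A ((A ^ m) v) := by rw [pow_succ']; rfl
        rw [h1]
        refine ⟨hV _ ih.1, (key _ ih.1).trans ?_⟩
        rw [pow_succ', mul_assoc]
        gcongr
        exact ih.2
    exact (this (n + 1)).2
  -- Taking (n+1)-th roots makes the bound linear in ‖v‖, as an operator-norm estimate requires.
  · have hle : ‖A.comp V.subtypeL‖ ≤
        ‖(A ^ (n + 1)).comp V.subtypeL‖ ^ ((n + 1 : ℝ)⁻¹) := by
      refine ContinuousLinearMap.opNorm_le_bound _ (by positivity) fun v => ?_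
      have h1 := norm_apply_pow_le A hA v n
      have h2 : ‖(A ^ (n + 1)) (v : E)‖ ≤ ‖(A ^ (n + 1)).comp V.subtypeL‖ * ‖v‖ :=
        ((A ^ (n + 1)).comp V.subtypeL).le_opNorm v
      refine le_of_pow_le_pow_left₀ (Nat.succ_ne_zero n) (by positivity) ?_
      rw [mul_pow]
      have h3 : (‖(A ^ (n + 1)).comp V.subtypeL‖ ^ ((n + 1 : ℝ)⁻¹)) ^ (n + 1) =
          ‖(A ^ (n + 1)).comp V.subtypeL‖ := by
        have := Real.rpow_inv_natCast_pow (norm_nonneg ((A ^ (n + 1)).comp V.subtypeL))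
          (Nat.succ_ne_zero n)
        simpa using this
      rw [Nat.succ_eq_add_one, h3]
      calc ‖A v‖ ^ (n + 1) ≤ _ := h1
        _ ≤ (‖(A ^ (n + 1)).comp V.subtypeL‖ * ‖v‖) * ‖v‖ ^ n := by gcongr; exact le_rfl
        _ = _ := by ring
    calc ‖A.comp V.subtypeL‖ ^ (n + 1)
        ≤ (‖(A ^ (n + 1)).comp V.subtypeL‖ ^ ((n + 1 : ℝ)⁻¹)) ^ (n + 1) := by gcongr
      _ = _ := by
        have := Real.rpow_inv_natCast_pow (norm_nonneg ((A ^ (n + 1)).comp V.subtypeL))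
          (Nat.succ_ne_zero n)
        simpa using this

theorem enorm_pow_comp_subtypeL (A : E →L[ℝ] E)
    (hA : ∀ v w, inner ℝ (A v) w = inner ℝ v (A w)) (V : Submodule ℝ E) (hV : ∀ v ∈ V, A v ∈ V)
    (n : ℕ) :
    ‖(A ^ (n + 1)).comp V.subtypeL‖ₑ = ‖A.comp V.subtypeL‖ₑ ^ (n + 1) := by
  rw [← ofReal_norm, norm_pow_comp_subtypeL A hA V hV,
    ENNReal.ofReal_pow (ContinuousLinearMap.opNorm_nonneg _),
    ofReal_norm]

end OperatorPowers

/-! ### Convergence of iterations to a set of fixed points -/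

section LocalConvergence

variable {E F : Type*} [NormedAddCommGroup E] [CompleteSpace E] [NormedAddCommGroup F]

/-- If `Ψ` contracts along the iteration of `G` near a zero of `Ψ` and controls the step size, then
the iteration started near that zero converges to a nearby zero. -/
theorem eventually_tendsto_iterate {G : E → E} {Ψ : E → F} {p : E} (hΨ : Continuous Ψ)
    (hp : Ψ p = 0) {q C : ℝ} (hq0 : 0 ≤ q) (hq : q < 1) (hC : 0 ≤ C)
    (hcontr : ∀ᶠ x in 𝓝 p, ‖Ψ (G x)‖ ≤ q * ‖Ψ x‖)
    (hstep : ∀ᶠ x in 𝓝 p, ‖G x - x‖ ≤ C * ‖Ψ x‖) {U : Set E} (hU : U ∈ 𝓝 p) :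
    ∀ᶠ x in 𝓝 p, ∃ l ∈ U, Ψ l = 0 ∧ Tendsto (fun n => G^[n] x) atTop (𝓝 l) := by
  obtain ⟨r, hr, hball⟩ := Metric.eventually_nhds_iff_ball.1 ((hcontr.and hstep).and hU)
  have hq1 : 0 < 1 - q := by linarith
  -- The second term is the geometric series bounding the total length of all future steps.
  have hsmall : ∀ᶠ x in 𝓝 p, dist x p + C * ‖Ψ x‖ / (1 - q) < r := by
    have : Tendsto (fun x => dist x p + C * ‖Ψ x‖ / (1 - q)) (𝓝 p)
        (𝓝 (dist p p + C * ‖Ψ p‖ / (1 - q))) := by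
      apply Continuous.tendsto; fun_prop
    rw [hp] at this
    simp only [dist_self, norm_zero, mul_zero, zero_div, add_zero] at this
    exact this.eventually (gt_mem_nhds hr)
  filter_upwards [hsmall] with x hx
  -- Distance to p plus the bound on the remaining path never exceeds its initial value, so the
  -- orbit stays where the local hypotheses apply.
  have main : ∀ n : ℕ, ‖Ψ (G^[n] x)‖ ≤ q ^ n * ‖Ψ x‖ ∧
      dist (G^[n] x) p + C * (q ^ n * ‖Ψ x‖) / (1 - q) ≤ dist x p + C * ‖Ψ x‖ / (1 - q) := by
    intro n
    induction n with
    | zero => simp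
    | succ n ih =>
      have hpos : 0 ≤ C * (q ^ n * ‖Ψ x‖) / (1 - q) := by positivity
      have hmem : G^[n] x ∈ Metric.ball p r := by
        rw [Metric.mem_ball]; linarith [ih.2]
      obtain ⟨⟨h1, h2⟩, -⟩ := hball _ hmem
      rw [Function.iterate_succ_apply']
      refine ⟨h1.trans ?_, ?_⟩
      · rw [pow_succ', mul_assoc]
        gcongr
        exact ih.1
      · have h3 : dist (G (G^[n] x)) p ≤ C * (q ^ n * ‖Ψ x‖) + dist (G^[n] x) p := by
          refine (dist_triangle _ (G^[n] x) _).trans ?_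
          gcongr
          rw [dist_eq_norm]
          refine h2.trans ?_
          gcongr
          exact ih.1
        have h4 : C * (q ^ n * ‖Ψ x‖) + C * (q ^ (n + 1) * ‖Ψ x‖) / (1 - q) =
            C * (q ^ n * ‖Ψ x‖) / (1 - q) := by
          field_simp; ring
        linarith [ih.2]
  have hmem : ∀ n, G^[n] x ∈ Metric.ball p r := fun n => by
    have hpos : 0 ≤ C * (q ^ n * ‖Ψ x‖) / (1 - q) := by positivity
    rw [Metric.mem_ball]; linarith [(main n).2]
  have hgeo : ∀ n, dist (G^[n] x) (G^[n + 1] x) ≤ (C * ‖Ψ x‖) * q ^ n := fun n => by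
    rw [dist_comm, dist_eq_norm, Function.iterate_succ_apply']
    refine (hball _ (hmem n)).1.2.trans ?_
    rw [mul_assoc, mul_comm ‖Ψ x‖]
    gcongr
    exact (main n).1
  obtain ⟨l, hl⟩ := cauchySeq_tendsto_of_complete (cauchySeq_of_le_geometric q _ hq hgeo)
  have hlr : l ∈ Metric.ball p r := by
    have := dist_le_of_le_geometric_of_tendsto₀ q _ hq hgeo hl
    simp only [Function.iterate_zero, id_eq] at this
    rw [Metric.mem_ball]
    calc dist l p ≤ dist x l + dist x p := by
          rw [dist_comm x l]; exact dist_triangle _ _ _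
      _ < r := by linarith
  refine ⟨l, (hball l hlr).2, ?_, hl⟩
  have h1 : Tendsto (fun n => ‖Ψ (G^[n] x)‖) atTop (𝓝 ‖Ψ l‖) :=
    ((hΨ.norm).tendsto l).comp hl
  have h2 : Tendsto (fun n => ‖Ψ (G^[n] x)‖) atTop (𝓝 0) := by
    refine squeeze_zero (fun _ => norm_nonneg _) (fun n => (main n).1) ?_
    simpa using (tendsto_pow_atTop_nhds_zero_of_lt_one hq0 hq).mul_const ‖Ψ x‖
  exact norm_eq_zero.1 (tendsto_nhds_unique h1 h2)

end LocalConvergence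

/-! ### Null sets -/

section NullSets

/-- A closed set all of whose translates in one direction are disjoint is a null set. -/
theorem measure_zero_of_isClosed_of_line {E : Type*} [NormedAddCommGroup E] [NormedSpace ℝ E]
    [MeasurableSpace E] [BorelSpace E] (m : Measure E) [SigmaFinite m] [m.IsAddLeftInvariant]
    {W : Set E} (hW : IsClosed W) {v : E}
    (h : ∀ x ∈ W, ∀ y ∈ W, ∀ t : ℝ, x - y = t • v → t = 0) : m W = 0 := by
  by_contra hne
  have hmeas : ∀ t : ℝ, MeasurableSet ((fun x => t • v + x) ⁻¹' W) := fun t =>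
    (hW.preimage (by fun_prop)).measurableSet
  have hdisj : Pairwise (Function.onFun Disjoint fun t : ℝ => (fun x => t • v + x) ⁻¹' W) := by
    intro s t hst
    refine Set.disjoint_left.2 fun x hx hy => hst ?_
    have := h _ hx _ hy (s - t) (by simp [sub_smul])
    linarith
  -- A σ-finite measure admits only countably many disjoint measurable sets of positive measure,
  -- whereas these translates, indexed by ℝ, all have the measure of W.
  have hcount := Measure.countable_meas_pos_of_disjoint_iUnion (μ := m) hmeas hdisj
  have huniv : {t : ℝ | 0 < m ((fun x => t • v + x) ⁻¹' W)} = Set.univ := by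
    ext t
    simp [measure_preimage_add, pos_iff_ne_zero, hne]
  rw [huniv] at hcount
  exact Set.not_countable_univ hcount

theorem NonSingular.iterate {D : ℕ}
    {f : EuclideanSpace ℝ (Fin D) → EuclideanSpace ℝ (Fin D)} (hf : NonSingular f) (n : ℕ) :
    NonSingular f^[n] := by
  induction n with
  | zero => intro A hA; simpa using hA
  | succ n ih =>
    intro A hA
    rw [Function.iterate_succ', Set.preimage_comp]
    exact ih _ (hf _ hA)

end NullSets

/-! ### Exponential separation near an unstable fixed point -/

section Cone

variable {E : Type*} [NormedAddCommGroup E] [InnerProductSpace ℝ E]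

/-- If an eigenvector of modulus greater than `1` carries the largest coordinate of `w`, then a
perturbation `w'` of the image of `w` has the same property, and its largest coordinate is larger
by a factor. -/
theorem exists_unstable_coord_le {ι : Type*} [Fintype ι] (b : OrthonormalBasis ι ℝ E) (ev : ι → ℝ)
    {ε : ℝ} (hev : ∀ i, 1 < |ev i| → 1 + 2 * ε ≤ |ev i|) {w w' : E} {i : ι} (hi : 1 < |ev i|)
    (hdom : ∀ j, |inner ℝ (b j) w| ≤ |inner ℝ (b i) w|)
    (herr : ∀ j, |inner ℝ (b j) w' - ev j * inner ℝ (b j) w| ≤ ε * |inner ℝ (b i) w|) :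
    ∃ k, 1 < |ev k| ∧ (∀ j, |inner ℝ (b j) w'| ≤ |inner ℝ (b k) w'|) ∧
      (1 + ε) * |inner ℝ (b i) w| ≤ |inner ℝ (b k) w'| := by
  classical
  -- Maximising over unstable indices suffices: coordinate i grows at least by (1 + 2ε) - ε, while a
  -- stable coordinate is at most 1 + ε times the old maximum.
  obtain ⟨k, hk, hmax⟩ := Finset.exists_max_image (Finset.univ.filter fun j => 1 < |ev j|)
    (fun j => |inner ℝ (b j) w'|) ⟨i, by simpa using hi⟩
  simp only [Finset.mem_filter, Finset.mem_univ, true_and] at hk hmax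
  have hgrow : (1 + ε) * |inner ℝ (b i) w| ≤ |inner ℝ (b i) w'| := by
    have h1 := (abs_sub_abs_le_abs_sub (ev i * inner ℝ (b i) w) (inner ℝ (b i) w'))
    rw [abs_sub_comm, abs_mul] at h1
    have h2 := mul_le_mul_of_nonneg_right (hev i hi) (abs_nonneg (inner ℝ (b i) w))
    linarith [herr i]
  refine ⟨k, hk, fun j => ?_, hgrow.trans (hmax i hi)⟩
  by_cases hj : 1 < |ev j|
  · exact hmax j hj
  · have h1 := (abs_sub_abs_le_abs_sub (inner ℝ (b j) w') (ev j * inner ℝ (b j) w))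
    rw [abs_mul] at h1
    have h2 : |ev j| * |inner ℝ (b j) w| ≤ 1 * |inner ℝ (b i) w| :=
      mul_le_mul (not_lt.1 hj) (hdom j) (abs_nonneg _) zero_le_one
    have := hmax i hi
    linarith [herr j]

theorem OrthonormalBasis.norm_le_card_mul {ι : Type*} [Fintype ι] (b : OrthonormalBasis ι ℝ E)
    {w : E} {m : ℝ} (h : ∀ j, |inner ℝ (b j) w| ≤ m) : ‖w‖ ≤ Fintype.card ι * m := by
  rw [← b.sum_repr' w]
  refine (norm_sum_le _ _).trans ?_
  refine (Finset.sum_le_sum (g := fun _ => m) fun j _ => ?_).trans (by simp)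
  rw [norm_smul, b.norm_eq_one, mul_one]
  exact h j

/-- If the derivative of `G` at `p` has an orthonormal eigenbasis with an eigenvalue of modulus
greater than `1`, then almost no orbit of `G` stays near `p`. -/
theorem measure_forall_iterate_mem_closedBall_eq_zero [FiniteDimensional ℝ E]
    [MeasurableSpace E] [BorelSpace E] (m : Measure E) [SigmaFinite m] [m.IsAddLeftInvariant]
    {G : E → E} (hGc : Continuous G) {A : E →L[ℝ] E} {p : E} (hG : HasStrictFDerivAt G A p)
    {ι : Type*} [Fintype ι] (b : OrthonormalBasis ι ℝ E) (ev : ι → ℝ)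
    (hb : ∀ i w, inner ℝ (b i) (A w) = ev i * inner ℝ (b i) w) {i₀ : ι} (hi₀ : 1 < |ev i₀|) :
    ∃ r > 0, m {x | ∀ n, G^[n] x ∈ Metric.closedBall p r} = 0 := by
  obtain ⟨ε, hε, hev⟩ : ∃ ε > 0, ∀ i, 1 < |ev i| → 1 + 2 * ε ≤ |ev i| := by
    have : ∀ᶠ ε : ℝ in 𝓝[>] 0, ∀ i, 1 < |ev i| → 1 + 2 * ε ≤ |ev i| := by
      refine Filter.eventually_all.2 fun i => ?_
      by_cases hi : 1 < |ev i|
      · have ht : Tendsto (fun ε : ℝ => 1 + 2 * ε) (𝓝 0) (𝓝 (1 + 2 * 0)) :=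
          Continuous.tendsto (by fun_prop) 0
        rw [mul_zero, add_zero] at ht
        filter_upwards [nhdsWithin_le_nhds (ht.eventually (gt_mem_nhds hi))] with ε h _ using h.le
      · exact Eventually.of_forall fun _ h => absurd h hi
    obtain ⟨ε, h1, h2⟩ := (this.and self_mem_nhdsWithin).exists
    exact ⟨ε, h2, h1⟩
  -- Passing from the largest coordinate to the norm costs a factor `card ι`; the extra 1 keeps K
  -- positive. Precision ε / K then leaves an error ε per coordinate.
  set K : ℝ := Fintype.card ι + 1
  have hK : 0 < K := by positivity
  -- Strict differentiability is needed: two moving points are compared, neither of which is p.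
  have hlo := hG.isLittleO.def (div_pos hε hK)
  rw [nhds_prod_eq, Metric.nhds_basis_closedBall.prod_self.eventually_iff] at hlo
  obtain ⟨r, hr, hlo⟩ := hlo
  refine ⟨r, hr, measure_zero_of_isClosed_of_line m (v := b i₀) ?_ ?_⟩
  · simp only [Set.ofPred_forall]
    exact isClosed_iInter fun n => Metric.isClosed_closedBall.preimage (hGc.iterate n)
  intro x hx y hy t hxy
  -- The dominant unstable index may change with n; only the growth of its coordinate matters.
  have main : ∀ n : ℕ, ∃ i, 1 < |ev i| ∧
      (∀ j, |inner ℝ (b j) (G^[n] x - G^[n] y)| ≤ |inner ℝ (b i) (G^[n] x - G^[n] y)|) ∧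
      (1 + ε) ^ n * |t| ≤ |inner ℝ (b i) (G^[n] x - G^[n] y)| := by
    intro n
    induction n with
    | zero =>
      classical
      refine ⟨i₀, hi₀, fun j => ?_, ?_⟩
      · simp only [Function.iterate_zero, id_eq, hxy, inner_smul_right,
          orthonormal_iff_ite.1 b.orthonormal]
        split_ifs <;> simp
      · simp [hxy, inner_smul_right, b.norm_eq_one]
    | succ n ih =>
      obtain ⟨i, hi, hdom, hle⟩ := ih
      have hnorm := b.norm_le_card_mul hdom
      have he := hlo (Set.mk_mem_prod (hx n) (hy n))
      simp only at he
      have herr : ∀ j, |inner ℝ (b j) (G^[n + 1] x - G^[n + 1] y) -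
          ev j * inner ℝ (b j) (G^[n] x - G^[n] y)| ≤
          ε * |inner ℝ (b i) (G^[n] x - G^[n] y)| := by
        intro j
        rw [Function.iterate_succ_apply', Function.iterate_succ_apply', ← hb, ← inner_sub_right]
        refine (abs_real_inner_le_norm _ _).trans ?_
        rw [b.norm_eq_one, one_mul]
        refine he.trans ?_
        rw [div_mul_eq_mul_div, div_le_iff₀ hK, mul_assoc]
        refine mul_le_mul_of_nonneg_left (hnorm.trans ?_) hε.le
        rw [mul_comm]
        exact mul_le_mul_of_nonneg_left (by simp [K]) (abs_nonneg _)
      obtain ⟨k, hk, hkdom, hkle⟩ := exists_unstable_coord_le b ev hev hi hdom herr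
      refine ⟨k, hk, hkdom, le_trans ?_ hkle⟩
      rw [pow_succ', mul_assoc]
      gcongr
  by_contra ht
  have hbdd : ∀ n : ℕ, (1 + ε) ^ n * |t| ≤ 2 * r := fun n => by
    obtain ⟨i, -, -, h⟩ := main n
    refine h.trans ((abs_real_inner_le_norm _ _).trans ?_)
    rw [b.norm_eq_one, one_mul, ← dist_eq_norm]
    have h1 := dist_triangle_right (G^[n] x) (G^[n] y) p
    have h2 : dist (G^[n] x) p ≤ r := hx n
    have h3 : dist (G^[n] y) p ≤ r := hy n
    linarith
  obtain ⟨n, hn⟩ := pow_unbounded_of_one_lt (2 * r / |t|) (show 1 < 1 + ε by linarith)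
  rw [div_lt_iff₀ (abs_pos.2 ht)] at hn
  exact absurd (hbdd n) (not_le.2 hn)

/-- A symmetric operator has an orthonormal eigenbasis, and it is a contraction if no eigenvalue
exceeds `1` in modulus. -/
theorem exists_orthonormal_eigenbasis [FiniteDimensional ℝ E] (A : E →L[ℝ] E)
    (hA : ∀ v w, inner ℝ (A v) w = inner ℝ v (A w)) :
    ∃ (b : OrthonormalBasis (Fin (Module.finrank ℝ E)) ℝ E) (ev : Fin (Module.finrank ℝ E) → ℝ),
      (∀ i w, inner ℝ (b i) (A w) = ev i * inner ℝ (b i) w) ∧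
      ((∀ i, |ev i| ≤ 1) → ∀ w, ‖A w‖ ≤ ‖w‖) := by
  have hs : (A : E →ₗ[ℝ] E).IsSymmetric := hA
  have hb : ∀ i w, inner ℝ (hs.eigenvectorBasis rfl i) (A w) =
      hs.eigenvalues rfl i * inner ℝ (hs.eigenvectorBasis rfl i) w := fun i w => by
    rw [← hA]
    have := hs.apply_eigenvectorBasis rfl i
    simp only [ContinuousLinearMap.coe_coe] at this
    rw [this, inner_smul_left]
    simp
  refine ⟨hs.eigenvectorBasis rfl, hs.eigenvalues rfl, hb, fun h w => ?_⟩
  refine le_of_sq_le_sq ?_ (norm_nonneg _)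
  rw [← (hs.eigenvectorBasis rfl).sum_sq_norm_inner_right w,
    ← (hs.eigenvectorBasis rfl).sum_sq_norm_inner_right (A w)]
  refine Finset.sum_le_sum fun i _ => ?_
  rw [hb, norm_mul, mul_pow]
  refine mul_le_of_le_one_left (by positivity) ?_
  exact pow_le_one₀ (norm_nonneg _) (h i)

end Cone

/-! ### Gradients and loss functions -/

theorem ContDiff.gradient_of_add_one_le {E : Type*} [NormedAddCommGroup E] [InnerProductSpace ℝ E]
    [CompleteSpace E] {f : E → ℝ} {m n : WithTop ℕ∞} (hf : ContDiff ℝ n f) (hmn : m + 1 ≤ n) :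
    ContDiff ℝ m (gradient f) :=
  (InnerProductSpace.toDual ℝ E).symm.toContinuousLinearEquiv.contDiff.comp (hf.fderiv_right hmn)

theorem HasGradientAt.scalar_comp {E : Type*} [NormedAddCommGroup E] [InnerProductSpace ℝ E]
    [CompleteSpace E] {f : E → ℝ} {g x : E} {h : ℝ → ℝ} {h' : ℝ} (hh : HasDerivAt h h' (f x))
    (hf : HasGradientAt f g x) : HasGradientAt (fun y => h (f y)) (h' • g) x := by
  rw [hasGradientAt_iff_hasFDerivAt] at hf ⊢
  rw [map_smulₛₗ]
  exact hh.comp_hasFDerivAt x hf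

namespace IsLossFunction

variable {ℓ : ℝ → ℝ → ℝ} (hℓ : IsLossFunction ℓ)

theorem contDiff_deriv (hℓ : IsLossFunction ℓ) (z : ℝ) : ContDiff ℝ 1 (deriv fun a => ℓ a z) :=
  ((contDiff_succ_iff_deriv (n := 1)).1 (hℓ.contDiff z)).2.2

theorem hasDerivAt (hℓ : IsLossFunction ℓ) (a z : ℝ) :
    HasDerivAt (fun a => ℓ a z) (deriv (fun a => ℓ a z) a) a :=
  ((hℓ.contDiff z).differentiable (by norm_num) a).hasDerivAt

theorem hasDerivAt_deriv_diag (hℓ : IsLossFunction ℓ) (z : ℝ) :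
    HasDerivAt (deriv fun a => ℓ a z) 1 z := by
  have h := hℓ.deriv_two_diag z
  rw [iteratedDeriv_succ, iteratedDeriv_one] at h
  rw [← h]
  exact ((hℓ.contDiff_deriv z).differentiable one_ne_zero z).hasDerivAt

end IsLossFunction

/-! ### Hessian and residual at interpolation solutions -/

namespace RegressionProblem

variable {D d N : ℕ} (R : RegressionProblem D d N)

theorem mem_interpSet_iff (hN : 0 < N) (hℓ : IsLossFunction R.ℓ)
    (x : EuclideanSpace ℝ (Fin D)) : x ∈ R.interpSet ↔ ∀ i, R.F x (R.y i) = R.z i := by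
  have hN' : (1 / (N : ℝ)) ≠ 0 := by positivity
  simp only [interpSet, Set.mem_ofPred_eq, empLoss, mul_eq_zero, hN', false_or, indivLoss]
  rw [Finset.sum_eq_zero_iff_of_nonneg fun i _ => hℓ.nonneg _ _]
  simp [hℓ.eq_zero_iff]

theorem contDiff_network_left (hF : ContDiff ℝ ∞
      (fun p : EuclideanSpace ℝ (Fin D) × EuclideanSpace ℝ (Fin d) => R.F p.1 p.2)) (i : Fin N) :
    ContDiff ℝ ∞ fun x => R.F x (R.y i) :=
  hF.comp (contDiff_id.prodMk contDiff_const)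

theorem contDiff_netGrad {i : Fin N} (hF : ContDiff ℝ ∞ fun x => R.F x (R.y i)) :
    ContDiff ℝ 1 (R.netGrad i) :=
  hF.gradient_of_add_one_le (by norm_cast)

theorem hasGradientAt_network {i : Fin N} (hF : ContDiff ℝ ∞ fun x => R.F x (R.y i))
    (x : EuclideanSpace ℝ (Fin D)) :
    HasGradientAt (fun x => R.F x (R.y i)) (R.netGrad i x) x :=
  (hF.differentiable (by simp) x).hasGradientAt

theorem gradient_empLoss (hF : ∀ i, ContDiff ℝ ∞ fun x => R.F x (R.y i))
    (hℓ : IsLossFunction R.ℓ) :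
    gradient R.empLoss = fun x => (1 / (N : ℝ)) •
      ∑ i, deriv (fun a => R.ℓ a (R.z i)) (R.F x (R.y i)) • R.netGrad i x := by
  ext1 x
  apply HasGradientAt.gradient
  rw [hasGradientAt_iff_hasFDerivAt, map_smulₛₗ, map_sum]
  refine HasFDerivAt.const_mul (HasFDerivAt.fun_sum
    (A := fun i => R.indivLoss i) fun i _ => ?_) _
  exact ((R.hasGradientAt_network (hF i) x).scalar_comp
    (hℓ.hasDerivAt _ (R.z i))).hasFDerivAt

theorem contDiff_gradient_empLoss (hF : ∀ i, ContDiff ℝ ∞ fun x => R.F x (R.y i))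
    (hℓ : IsLossFunction R.ℓ) : ContDiff ℝ 1 (gradient R.empLoss) := by
  rw [R.gradient_empLoss hF hℓ]
  apply ContDiff.const_smul
  apply ContDiff.sum
  intro i _
  exact ((hℓ.contDiff_deriv (R.z i)).comp ((hF i).of_le (by norm_cast))).smul
    (R.contDiff_netGrad (hF i))

/-- The Gram operator `∑ i, ∇F_i ⊗ ∇F_i`. -/
noncomputable def gramOp (p : EuclideanSpace ℝ (Fin D)) :
    EuclideanSpace ℝ (Fin D) →L[ℝ] EuclideanSpace ℝ (Fin D) :=
  ∑ i, InnerProductSpace.rankOne ℝ (R.netGrad i p) (R.netGrad i p)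

theorem gramOp_apply (p v : EuclideanSpace ℝ (Fin D)) :
    R.gramOp p v = ∑ i, inner ℝ (R.netGrad i p) v • R.netGrad i p := by
  simp [gramOp]

/-- In the product rule the second derivatives of the network carry the factor ∂₁ℓ(z,z) = 0, and the
remaining rank-one terms carry ∂₁²ℓ(z,z) = 1. -/
theorem hess_eq (hN : 0 < N) (hF : ∀ i, ContDiff ℝ ∞ fun x => R.F x (R.y i))
    (hℓ : IsLossFunction R.ℓ) {p : EuclideanSpace ℝ (Fin D)} (hp : p ∈ R.interpSet) :
    R.hess p = (1 / (N : ℝ)) • R.gramOp p := by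
  rw [mem_interpSet_iff R hN hℓ] at hp
  rw [hess, R.gradient_empLoss hF hℓ]
  refine HasFDerivAt.fderiv ?_
  refine HasFDerivAt.fun_const_smul (HasFDerivAt.fun_sum (A := fun i x =>
    deriv (fun a => R.ℓ a (R.z i)) (R.F x (R.y i)) • R.netGrad i x) fun i _ => ?_) _
  have h1 : HasDerivAt (deriv fun a => R.ℓ a (R.z i)) 1 (R.F p (R.y i)) := by
    rw [hp i]; exact hℓ.hasDerivAt_deriv_diag _
  have h2 := (h1.comp_hasFDerivAt p (R.hasGradientAt_network (hF i) p).hasFDerivAt).smul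
    ((R.contDiff_netGrad (hF i)).differentiable one_ne_zero p).hasFDerivAt
  refine h2.congr_fderiv ?_
  ext1 v
  simp [hp i, hℓ.deriv_diag]

theorem fderiv_gdMap (hF : ∀ i, ContDiff ℝ ∞ fun x => R.F x (R.y i))
    (hℓ : IsLossFunction R.ℓ) (η : ℝ) (p : EuclideanSpace ℝ (Fin D)) :
    fderiv ℝ (R.gdMap η) p = ContinuousLinearMap.id ℝ _ - η • R.hess p := by
  have h := ((R.contDiff_gradient_empLoss hF hℓ).differentiable one_ne_zero p).hasFDerivAt
  exact ((hasFDerivAt_id p).sub (h.const_smul η)).fderiv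

theorem contDiff_gdMap (hF : ∀ i, ContDiff ℝ ∞ fun x => R.F x (R.y i))
    (hℓ : IsLossFunction R.ℓ) (η : ℝ) : ContDiff ℝ 1 (R.gdMap η) :=
  contDiff_id.sub ((R.contDiff_gradient_empLoss hF hℓ).const_smul η)

theorem gramOp_mem_normalSpace (p v : EuclideanSpace ℝ (Fin D)) :
    R.gramOp p v ∈ R.normalSpace p := by
  rw [gramOp_apply]
  exact Submodule.sum_mem _ fun i _ =>
    Submodule.smul_mem _ _ (Submodule.subset_span (Set.mem_range_self i))

theorem inner_gramOp (p v w : EuclideanSpace ℝ (Fin D)) :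
    inner ℝ (R.gramOp p v) w = inner ℝ v (R.gramOp p w) := by
  simp only [gramOp_apply, sum_inner, inner_sum, inner_smul_left, inner_smul_right]
  refine Finset.sum_congr rfl fun i _ => ?_
  simp [real_inner_comm, mul_comm]

/-- The residuals `F(x, y_i) - z_i`, combined by the gradients at `p`. -/
noncomputable def residual (p x : EuclideanSpace ℝ (Fin D)) : EuclideanSpace ℝ (Fin D) :=
  ∑ i, (R.F x (R.y i) - R.z i) • R.netGrad i p

theorem residual_mem_normalSpace (p x : EuclideanSpace ℝ (Fin D)) :
    R.residual p x ∈ R.normalSpace p :=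
  Submodule.sum_mem _ fun i _ =>
    Submodule.smul_mem _ _ (Submodule.subset_span (Set.mem_range_self i))

theorem contDiff_residual (hF : ∀ i, ContDiff ℝ ∞ fun x => R.F x (R.y i))
    (p : EuclideanSpace ℝ (Fin D)) : ContDiff ℝ ∞ (R.residual p) :=
  ContDiff.sum fun i _ => ((hF i).sub contDiff_const).smul contDiff_const

theorem hasStrictFDerivAt_residual (hF : ∀ i, ContDiff ℝ ∞ fun x => R.F x (R.y i))
    (p : EuclideanSpace ℝ (Fin D)) : HasStrictFDerivAt (R.residual p) (R.gramOp p) p := by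
  refine (R.contDiff_residual hF p).contDiffAt.hasStrictFDerivAt' ?_ (by simp)
  refine HasFDerivAt.fun_sum fun i _ => ?_
  have h := ((R.hasGradientAt_network (hF i) p).hasFDerivAt.sub_const (R.z i)).smul_const
    (R.netGrad i p)
  refine h.congr_fderiv ?_
  ext1 v
  simp

theorem residual_eq_zero_iff (hN : 0 < N) (hℓ : IsLossFunction R.ℓ)
    {p : EuclideanSpace ℝ (Fin D)} (hp : LinearIndependent ℝ fun i => R.netGrad i p)
    (x : EuclideanSpace ℝ (Fin D)) : R.residual p x = 0 ↔ x ∈ R.interpSet := by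
  rw [R.mem_interpSet_iff hN hℓ]
  refine ⟨fun h i => sub_eq_zero.1 (Fintype.linearIndependent_iff.1 hp _ h i), fun h => ?_⟩
  simp [residual, h]

/-- Independence makes the combination map c ↦ ∑ cᵢ ∇Fᵢ(p) injective, hence bounded below in finite
dimension. -/
theorem isBigO_residual {p : EuclideanSpace ℝ (Fin D)}
    (hp : LinearIndependent ℝ fun i => R.netGrad i p) (i : Fin N)
    (l : Filter (EuclideanSpace ℝ (Fin D))) :
    (fun x => R.F x (R.y i) - R.z i) =O[l] R.residual p := by
  obtain ⟨K, -, hK⟩ := LinearMap.exists_antilipschitzWith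
    (Fintype.linearCombination ℝ fun i => R.netGrad i p)
    (LinearMap.ker_eq_bot.2 hp.fintypeLinearCombination_injective)
  refine Asymptotics.IsBigO.of_bound K (Eventually.of_forall fun x => ?_)
  have h := hK.le_mul_dist (fun j => R.F x (R.y j) - R.z j) 0
  rw [map_zero, dist_zero_right, dist_zero_right, Fintype.linearCombination_apply] at h
  exact (norm_le_pi_norm (fun j => R.F x (R.y j) - R.z j) i).trans h

/-- Two errors occur: ∂₁ℓ(a,z) - (a - z) = o(a - z), and freezing ∇Fᵢ at p costs o(1) times a
residual. -/
theorem isLittleO_gradient_sub_residual (hF : ∀ i, ContDiff ℝ ∞ fun x => R.F x (R.y i))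
    (hN : 0 < N) (hℓ : IsLossFunction R.ℓ) {p : EuclideanSpace ℝ (Fin D)}
    (hp : p ∈ R.interpSet) (hli : LinearIndependent ℝ fun i => R.netGrad i p) :
    (fun x => gradient R.empLoss x - (1 / (N : ℝ)) • R.residual p x) =o[𝓝 p] R.residual p := by
  rw [mem_interpSet_iff R hN hℓ] at hp
  have hsum : (fun x => gradient R.empLoss x - (1 / (N : ℝ)) • R.residual p x) =
      fun x => (1 / (N : ℝ)) • ∑ i,
        ((deriv (fun a => R.ℓ a (R.z i)) (R.F x (R.y i)) - (R.F x (R.y i) - R.z i)) •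
          R.netGrad i x + (R.F x (R.y i) - R.z i) • (R.netGrad i x - R.netGrad i p)) := by
    ext1 x
    rw [R.gradient_empLoss hF hℓ, residual, ← smul_sub, ← Finset.sum_sub_distrib]
    congr 1
    refine Finset.sum_congr rfl fun i _ => ?_
    module
  rw [hsum]
  refine Asymptotics.IsLittleO.const_smul_left ?_ (1 / (N : ℝ))
  apply Asymptotics.IsLittleO.fun_sum
  intro i _
  have hφ := R.isBigO_residual hli i (𝓝 p)
  have hg : Tendsto (R.netGrad i) (𝓝 p) (𝓝 (R.netGrad i p)) :=
    (R.contDiff_netGrad (hF i)).continuous.tendsto p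
  have hf : Tendsto (fun x => R.F x (R.y i)) (𝓝 p) (𝓝 (R.z i)) := by
    rw [← hp i]; exact (hF i).continuous.tendsto p
  have h1 : (fun x => deriv (fun a => R.ℓ a (R.z i)) (R.F x (R.y i)) - (R.F x (R.y i) - R.z i))
      =o[𝓝 p] fun x => R.F x (R.y i) - R.z i := by
    have := (hasDerivAt_iff_isLittleO.1 (hℓ.hasDerivAt_deriv_diag (R.z i))).comp_tendsto hf
    simpa [Function.comp_def, hℓ.deriv_diag] using this
  have h2 : (fun x => R.netGrad i x - R.netGrad i p) =o[𝓝 p] fun _ => (1 : ℝ) := by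
    rw [Asymptotics.isLittleO_one_iff]
    simpa using hg.sub_const (R.netGrad i p)
  refine Asymptotics.IsLittleO.add ?_ ?_
  · have := (h1.trans_isBigO hφ.norm_right).smul_isBigO (hg.isBigO_one ℝ)
    simpa using this.norm_right
  · have := hφ.norm_right.smul_isLittleO h2
    simpa using this.norm_right

theorem isBigO_gdMap_sub (hF : ∀ i, ContDiff ℝ ∞ fun x => R.F x (R.y i))
    (hN : 0 < N) (hℓ : IsLossFunction R.ℓ) {p : EuclideanSpace ℝ (Fin D)}
    (hp : p ∈ R.interpSet) (hli : LinearIndependent ℝ fun i => R.netGrad i p) (η : ℝ) :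
    (fun x => R.gdMap η x - x) =O[𝓝 p] R.residual p := by
  have h := (R.isLittleO_gradient_sub_residual hF hN hℓ hp hli).isBigO.add
    ((Asymptotics.isBigO_refl (R.residual p) (𝓝 p)).const_smul_left (1 / (N : ℝ)))
  refine (h.const_smul_left (-η)).congr_left fun x => ?_
  simp only [gdMap, Pi.smul_apply, sub_add_cancel]
  module

/-- Strict differentiability at the pair (Gx, x) gives Ψ(Gx) - Ψ(x) = Gram(Gx - x) + o(Gx - x). Here
Gx - x = -(η/N)Ψ(x) + o(Ψ(x)), and Gram/N is the Hessian. -/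
theorem isLittleO_residual_gdMap (hF : ∀ i, ContDiff ℝ ∞ fun x => R.F x (R.y i))
    (hN : 0 < N) (hℓ : IsLossFunction R.ℓ) {p : EuclideanSpace ℝ (Fin D)}
    (hp : p ∈ R.interpSet) (hli : LinearIndependent ℝ fun i => R.netGrad i p) (η : ℝ) :
    (fun x => R.residual p (R.gdMap η x) -
      (ContinuousLinearMap.id ℝ (EuclideanSpace ℝ (Fin D)) - η • R.hess p) (R.residual p x))
      =o[𝓝 p] R.residual p := by
  have hstep := R.isBigO_gdMap_sub hF hN hℓ hp hli η
  have hgp : R.gdMap η p = p := by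
    simp [gdMap, R.gradient_empLoss hF hℓ, (mem_interpSet_iff R hN hℓ p).1 hp, hℓ.deriv_diag]
  have ht : Tendsto (fun x => (R.gdMap η x, x)) (𝓝 p) (𝓝 (p, p)) := by
    have := ((R.contDiff_gdMap hF hℓ η).continuous.prodMk continuous_id).tendsto p
    simpa [hgp] using this
  have h1 := ((R.hasStrictFDerivAt_residual hF p).isLittleO.comp_tendsto ht).trans_isBigO hstep
  have h2 := ((R.gramOp p).isBigO_comp (fun x => gradient R.empLoss x -
    (1 / (N : ℝ)) • R.residual p x) (𝓝 p)).trans_isLittleO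
      (R.isLittleO_gradient_sub_residual hF hN hℓ hp hli)
  refine (h1.add (h2.const_smul_left (-η))).congr_left fun x => ?_
  rw [R.hess_eq hN hF hℓ hp]
  simp only [Function.comp_apply, gdMap, Pi.smul_apply, map_sub, map_smul,
    sub_apply, smul_apply, ContinuousLinearMap.id_apply]
  module

/-! ### The exponent μ -/

theorem inner_sub_smul_hess (hN : 0 < N) (hF : ∀ i, ContDiff ℝ ∞ fun x => R.F x (R.y i))
    (hℓ : IsLossFunction R.ℓ) {p : EuclideanSpace ℝ (Fin D)} (hp : p ∈ R.interpSet) (η : ℝ)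
    (v w : EuclideanSpace ℝ (Fin D)) :
    inner ℝ ((ContinuousLinearMap.id ℝ (EuclideanSpace ℝ (Fin D)) - η • R.hess p) v) w =
      inner ℝ v ((ContinuousLinearMap.id ℝ (EuclideanSpace ℝ (Fin D)) - η • R.hess p) w) := by
  simp [R.hess_eq hN hF hℓ hp, inner_sub_left, inner_sub_right, inner_smul_left, inner_smul_right,
    R.inner_gramOp p v w]

theorem sub_smul_hess_mem_normalSpace (hN : 0 < N)
    (hF : ∀ i, ContDiff ℝ ∞ fun x => R.F x (R.y i))
    (hℓ : IsLossFunction R.ℓ) {p : EuclideanSpace ℝ (Fin D)} (hp : p ∈ R.interpSet) (η : ℝ)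
    {v : EuclideanSpace ℝ (Fin D)} (hv : v ∈ R.normalSpace p) :
    (ContinuousLinearMap.id ℝ (EuclideanSpace ℝ (Fin D)) - η • R.hess p) v ∈
      R.normalSpace p := by
  rw [R.hess_eq hN hF hℓ hp]
  exact Submodule.sub_mem _ hv (Submodule.smul_mem _ _
    (Submodule.smul_mem _ _ (R.gramOp_mem_normalSpace p v)))

/-- The sequence is constant from index 1 on; index 0 is excluded because there the factor is the
default value 0⁻¹ = 0. -/
theorem muSeq_succ (hN : 0 < N) (hF : ∀ i, ContDiff ℝ ∞ fun x => R.F x (R.y i))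
    (hℓ : IsLossFunction R.ℓ) {p : EuclideanSpace ℝ (Fin D)} (hp : p ∈ R.interpSet) (η : ℝ)
    (n : ℕ) :
    R.muSeq η p (n + 1) = ENNReal.log
      ‖(ContinuousLinearMap.id ℝ (EuclideanSpace ℝ (Fin D)) - η • R.hess p).comp
        (R.normalSpace p).subtypeL‖ₑ := by
  have h := enorm_pow_comp_subtypeL _ (R.inner_sub_smul_hess hN hF hℓ hp η) (R.normalSpace p)
    (fun v hv => R.sub_smul_hess_mem_normalSpace hN hF hℓ hp η hv) n
  rw [muSeq, R.fderiv_gdMap hF hℓ, h, ENNReal.log_pow, ← mul_assoc]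
  have : (((((n + 1 : ℕ) : ℝ)⁻¹ : ℝ) : EReal)) * ((n + 1 : ℕ) : EReal) = 1 := by
    rw [← EReal.coe_natCast, ← EReal.coe_mul, inv_mul_cancel₀ (by positivity), EReal.coe_one]
  rw [this, one_mul]

theorem tendsto_muSeq (hN : 0 < N) (hF : ∀ i, ContDiff ℝ ∞ fun x => R.F x (R.y i))
    (hℓ : IsLossFunction R.ℓ) {p : EuclideanSpace ℝ (Fin D)} (hp : p ∈ R.interpSet) (η : ℝ) :
    Tendsto (R.muSeq η p) atTop (𝓝 (ENNReal.log
      ‖(ContinuousLinearMap.id ℝ (EuclideanSpace ℝ (Fin D)) - η • R.hess p).comp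
        (R.normalSpace p).subtypeL‖ₑ)) := by
  rw [← tendsto_add_atTop_iff_nat 1]
  simp only [R.muSeq_succ hN hF hℓ hp]
  exact tendsto_const_nhds

/-! ### Stability and instability of gradient descent -/

theorem gdLim_eq_some_iff {η : ℝ} {x₀ : EuclideanSpace ℝ (Fin D)} {p : R.interpSet} :
    R.gdLim η x₀ = some p ↔
      Tendsto (R.gdSeq η x₀) atTop (𝓝 (p : EuclideanSpace ℝ (Fin D))) := by
  rw [gdLim]
  constructor
  · intro h
    split_ifs at h with hx
    rw [← Option.some.inj h]
    exact hx.choose_spec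
  · intro h
    have hx : ∃ x : R.interpSet,
        Tendsto (R.gdSeq η x₀) atTop (𝓝 (x : EuclideanSpace ℝ (Fin D))) := ⟨p, h⟩
    rw [dif_pos hx]
    exact congrArg some (Subtype.ext (tendsto_nhds_unique hx.choose_spec h))

/-- Near a linearly stable interpolation solution, gradient descent converges to a nearby
interpolation solution. -/
theorem eventually_tendsto_gdSeq (hN : 0 < N) (hF : ∀ i, ContDiff ℝ ∞ fun x => R.F x (R.y i))
    (hℓ : IsLossFunction R.ℓ) {p : EuclideanSpace ℝ (Fin D)} (hp : p ∈ R.interpSet)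
    (hli : LinearIndependent ℝ fun i => R.netGrad i p) {η : ℝ}
    (hstable : ‖(ContinuousLinearMap.id ℝ (EuclideanSpace ℝ (Fin D)) - η • R.hess p).comp
        (R.normalSpace p).subtypeL‖ < 1)
    {U : Set (EuclideanSpace ℝ (Fin D))} (hU : U ∈ 𝓝 p) :
    ∀ᶠ x in 𝓝 p, ∃ l ∈ U, l ∈ R.interpSet ∧ Tendsto (R.gdSeq η x) atTop (𝓝 l) := by
  set a := ‖(ContinuousLinearMap.id ℝ (EuclideanSpace ℝ (Fin D)) - η • R.hess p).comp
    (R.normalSpace p).subtypeL‖ with ha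
  have ha0 : 0 ≤ a := ContinuousLinearMap.opNorm_nonneg _
  obtain ⟨C, hC, hstep⟩ := (R.isBigO_gdMap_sub hF hN hℓ hp hli η).exists_nonneg
  -- The rate is the midpoint of a and 1. The bound a applies because the residual lies in the
  -- normal space.
  have hcontr : ∀ᶠ x in 𝓝 p,
      ‖R.residual p (R.gdMap η x)‖ ≤ (a + (1 - a) / 2) * ‖R.residual p x‖ := by
    filter_upwards [(R.isLittleO_residual_gdMap hF hN hℓ hp hli η).def
      (show 0 < (1 - a) / 2 by linarith)] with x hx
    have h1 : ‖(ContinuousLinearMap.id ℝ (EuclideanSpace ℝ (Fin D)) - η • R.hess p)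
        (R.residual p x)‖ ≤ a * ‖R.residual p x‖ :=
      ((ContinuousLinearMap.id ℝ (EuclideanSpace ℝ (Fin D)) - η • R.hess p).comp
        (R.normalSpace p).subtypeL).le_opNorm ⟨_, R.residual_mem_normalSpace p x⟩
    have h2 := norm_le_norm_add_norm_sub' (R.residual p (R.gdMap η x))
      ((ContinuousLinearMap.id ℝ (EuclideanSpace ℝ (Fin D)) - η • R.hess p) (R.residual p x))
    rw [add_mul]
    linarith
  filter_upwards [eventually_tendsto_iterate (R.contDiff_residual hF p).continuous
    ((R.residual_eq_zero_iff hN hℓ hli p).2 hp) (by linarith) (by linarith) hC hcontr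
    hstep.bound hU] with x hx
  obtain ⟨l, hl, hl0, hlim⟩ := hx
  exact ⟨l, hl, (R.residual_eq_zero_iff hN hℓ hli l).1 hl0, hlim⟩

/-- Near a linearly unstable interpolation solution, almost no gradient descent sequence
converges. -/
theorem exists_ball_measure_tendsto_gdSeq_eq_zero (hN : 0 < N)
    (hF : ∀ i, ContDiff ℝ ∞ fun x => R.F x (R.y i))
    (hℓ : IsLossFunction R.ℓ) {p : EuclideanSpace ℝ (Fin D)} (hp : p ∈ R.interpSet) {η : ℝ}
    (hG : NonSingular (R.gdMap η))
    (hunstable : 1 < ‖(ContinuousLinearMap.id ℝ (EuclideanSpace ℝ (Fin D)) - η • R.hess p).comp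
        (R.normalSpace p).subtypeL‖) :
    ∃ r > 0, volume {x | ∃ l ∈ Metric.ball p r, Tendsto (R.gdSeq η x) atTop (𝓝 l)} = 0 := by
  set A := ContinuousLinearMap.id ℝ (EuclideanSpace ℝ (Fin D)) - η • R.hess p with hA
  obtain ⟨b, ev, hb, hcontr⟩ := exists_orthonormal_eigenbasis A
    (R.inner_sub_smul_hess hN hF hℓ hp η)
  -- Otherwise A would be a contraction on the whole space; the eigenvector need not be located in
  -- the normal space.
  obtain ⟨i₀, hi₀⟩ : ∃ i, 1 < |ev i| := by
    by_contra! h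
    refine absurd (ContinuousLinearMap.opNorm_le_bound _ zero_le_one fun v => ?_)
      (not_le.2 hunstable)
    rw [one_mul]
    exact hcontr h v
  have hc := R.contDiff_gdMap hF hℓ η
  have hd : HasStrictFDerivAt (R.gdMap η) A p := by
    rw [hA, ← R.fderiv_gdMap hF hℓ]
    exact hc.contDiffAt.hasStrictFDerivAt one_ne_zero
  obtain ⟨r, hr, hnull⟩ := measure_forall_iterate_mem_closedBall_eq_zero volume hc.continuous hd
    b ev hb hi₀
  refine ⟨r, hr, measure_mono_null (fun x ⟨l, hl, hlim⟩ => ?_)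
    (measure_iUnion_null fun k : ℕ => hG.iterate k _ hnull)⟩
  obtain ⟨k, hk⟩ := eventually_atTop.1
    (hlim.eventually (Metric.isOpen_ball.mem_nhds hl))
  refine Set.mem_iUnion.2 ⟨k, fun n => Metric.ball_subset_closedBall ?_⟩
  rw [← Function.iterate_add_apply]
  exact hk (n + k) (Nat.le_add_left k n)

end RegressionProblem

theorem theorem1 {D d N : ℕ} (hN : 0 < N) (R : RegressionProblem D d N)
    (hF : ContDiff ℝ ∞
      (fun p : EuclideanSpace ℝ (Fin D) × EuclideanSpace ℝ (Fin d) => R.F p.1 p.2))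
    (hℓ : IsLossFunction R.ℓ)
    (η : ℝ) (hη : 0 < η)
    -- the gradients are linearly independent at every interpolation solution
    (hM : ∀ x ∈ R.interpSet, LinearIndependent ℝ (fun i => R.netGrad i x))
    -- the initial distribution is equivalent to Lebesgue measure
    (ν : Measure (EuclideanSpace ℝ (Fin D))) [IsProbabilityMeasure ν]
    (hν : ∀ B : Set (EuclideanSpace ℝ (Fin D)), MeasurableSet B → (ν B = 0 ↔ volume B = 0))
    -- the GD map and the SGD maps are non-singular
    (hG : NonSingular (R.gdMap η)) (hGi : ∀ i, NonSingular (R.sgdMap η i))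
    -- the random initialization
    {Ω : Type*} [MeasurableSpace Ω] (P : Measure Ω) [IsProbabilityMeasure P]
    (X₀ : Ω → EuclideanSpace ℝ (Fin D)) (hX₀ : Measurable X₀) (hlaw : P.map X₀ = ν)
    (xs : R.interpSet) :
    -- `μ` is well defined: the limit exists and equals `log ‖(1 - η Hess L) restricted to N‖`
    (Tendsto (R.muSeq η xs) atTop (𝓝 (R.mu η xs)) ∧
      R.mu η xs = ENNReal.log
        ‖(ContinuousLinearMap.id ℝ (EuclideanSpace ℝ (Fin D)) - η • R.hess xs).comp
          (R.normalSpace xs).subtypeL‖ₑ) ∧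
    (R.mu η xs < 0 → xs ∈ randomSupport P (fun o => R.gdLim η (X₀ o))) ∧
    (0 < R.mu η xs → xs ∉ randomSupport P (fun o => R.gdLim η (X₀ o))) := by
  have hFi := R.contDiff_network_left hF
  have hlim := R.tendsto_muSeq hN hFi hℓ xs.2 η
  have hmu := hlim.limsup_eq
  change R.mu η xs = _ at hmu
  have hlawc : ∀ B, MeasurableSet B → (P (X₀ ⁻¹' B) = 0 ↔ volume B = 0) := fun B hB => by
    rw [← hν B hB, ← hlaw, Measure.map_apply hX₀ hB]
  refine ⟨⟨hmu ▸ hlim, hmu⟩, fun h => ?_, fun h hsupp => ?_⟩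
  · rw [hmu, ENNReal.log_lt_zero_iff, ← ofReal_norm, ENNReal.ofReal_lt_one] at h
    intro U hU hxU
    obtain ⟨V, hV, rfl⟩ := isOpen_induced_iff.1 hU
    have hev := R.eventually_tendsto_gdSeq hN hFi hℓ xs.2 (hM _ xs.2) h (hV.mem_nhds hxU)
    obtain ⟨W, hW, hWo, hxW⟩ := eventually_nhds_iff.1 hev
    have hpos : P (X₀ ⁻¹' W) ≠ 0 := fun h0 =>
      (hWo.measure_pos volume ⟨_, hxW⟩).ne' ((hlawc W hWo.measurableSet).1 h0)
    refine (pos_iff_ne_zero.2 hpos).trans_le (measure_mono fun o ho => ?_)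
    obtain ⟨l, hlV, hlM, hl⟩ := hW _ ho
    exact ⟨⟨l, hlM⟩, hlV, R.gdLim_eq_some_iff.2 hl⟩
  · rw [hmu, ENNReal.zero_lt_log_iff, ← ofReal_norm, ENNReal.one_lt_ofReal] at h
    obtain ⟨r, hr, hnull⟩ := R.exists_ball_measure_tendsto_gdSeq_eq_zero hN hFi hℓ xs.2 hG h
    -- The equivalence of ν with Lebesgue measure concerns measurable sets only, so the null set is
    -- enlarged.
    obtain ⟨B, hsub, hB, hB0⟩ := exists_measurable_superset_of_null hnull
    refine (hsupp (Subtype.val ⁻¹' Metric.ball xs r)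
      (Metric.isOpen_ball.preimage continuous_subtype_val) (Metric.mem_ball_self hr)).ne' ?_
    refine measure_mono_null (fun o ho => ?_) ((hlawc B hB).2 hB0)
    obtain ⟨u, hu, hou⟩ := ho
    exact hsub ⟨u, hu, R.gdLim_eq_some_iff.1 hou⟩
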